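/- Let $G$ be a finite simple triangle-free $r$-regular graph with $p\ge 1$ vertices and $q$ edges, where $r\ge 2$, and let $\lambda_1\ge\lambda_2\ge\dots\ge\lambda_p$ be the eigenvalues of its adjacency matrix, repeated according to multiplicity. The central graph $C[G]$ is obtained from $G$ by inserting one new vertex into each edge of $G$ (so that the edge is replaced by a path of length $2$ through the new vertex) and joining every two distinct vertices of $G$ that are not adjacent in $G$. For a connected graph $H$ with distance $d$ and eccentricities $e(u)=\max_v d(u,v)$, the eccentricity matrix $\epsilon(H)$ has the entry $d(u,v)$ at $(u,v)$ if $d(u,v)=\min\{e(u),e(v)\}$, and $0$ otherwise; the $\epsilon$-spectrum of $H$ is the multiset of the eigenvalues of $\epsilon(H)$, with multiplicities. Then $C[G]$ is connected, $\lambda_1=r$, and the $\epsilon$-spectrum of $C[G]$ consists exactly of the following $p+q$ numbers, counted with multiplicity: 1. $3$, with multiplicity $q-p$; 2. for each $i=2,\dots,p$, the two numbers $$\frac{3-(3r+\lambda_i)\pm\sqrt{(5\lambda_i+3(r-1))^2+16(\lambda_i+r)}}{2};$$ 3. the two numbers $$\frac{(3q-4r+3)\pm\sqrt{(3q-8r+3)^2+16(p-2)(q-r)}}{2}.$$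 Moreover, the partition of the vertices of $C[G]$ into the vertices of $G$ and the new vertices is equitable for $\epsilon(C[G])$ (within each block all row sums are equal), with quotient matrix $$\begin{pmatrix}2r&2(q-r)\\2(p-2)&3(q-2r+1)\end{pmatrix},$$ and the two numbers in 3 are the eigenvalues of this matrix. -/

import Mathlib

open Finset Polynomial

namespace EccSpec

/-- The central graph `C[G]`: its vertices are those of `G` together with one new vertex for each
edge of `G`. Two vertices of `G` are joined iff they are distinct and not adjacent in `G`; the
vertex of an edge is joined exactly to the two ends of that edge. -/
def centralGraph {V : Type*} (G : SimpleGraph V) : SimpleGraph (V ⊕ G.edgeSet) where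
  Adj
    | Sum.inl u, Sum.inl v => u ≠ v ∧ ¬ G.Adj u v
    | Sum.inl u, Sum.inr e => u ∈ (e : Sym2 V)
    | Sum.inr e, Sum.inl u => u ∈ (e : Sym2 V)
    | Sum.inr _, Sum.inr _ => False
  symm := ⟨by
    rintro (u | e) (v | f) h
    · exact ⟨h.1.symm, fun h' => h.2 h'.symm⟩
    · exact h
    · exact h
    · exact h⟩
  loopless := ⟨by
    rintro (u | e) h
    · exact h.1 rfl
    · exact h⟩

/-- The eccentricity matrix of a graph: the entry at `(u, v)` is `d(u, v)` if
`d(u, v) = min {e(u), e(v)}`, and `0` otherwise. (For a connected finite graph all the distances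
and eccentricities, which Mathlib takes in `ℕ∞`, are finite.) -/
noncomputable def eccMatrix {W : Type*} (H : SimpleGraph W) : Matrix W W ℝ :=
  Matrix.of fun u v => if H.edist u v = min (H.eccent u) (H.eccent v) then (H.dist u v : ℝ) else 0

/-- The `ε`-spectrum: the eigenvalues of the eccentricity matrix as a multiset, each one repeated
according to its algebraic multiplicity. -/
noncomputable def eccSpectrum {W : Type*} [Fintype W] [DecidableEq W] (H : SimpleGraph W) :
    Multiset ℝ :=
  (eccMatrix H).charpoly.roots

/-- `Q` is the quotient matrix of `M` for the partition of the index set into the fibres of `c`, and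
this partition is equitable: within each block of `M` all the row sums equal the entry of `Q`. -/
def IsEquitableQuotient {W I : Type*} [Fintype W] [DecidableEq I]
    (M : Matrix W W ℝ) (c : W → I) (Q : Matrix I I ℝ) : Prop :=
  Function.Surjective c ∧ ∀ w k, ∑ x with c x = k, M w x = Q (c w) k

end EccSpec

namespace EccSpec

open Matrix SimpleGraph

/-! ### Distances in the central graph. -/

section Graph

variable {V : Type*} {G : SimpleGraph V} {r : ℕ}

/-! In `C[G]` the original vertices have eccentricity 2 and the new ones 3, so the nonzero entries
of `ε` are 2 for adjacent vertices and for a vertex off an edge, and 3 for disjoint edges. With `N`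
the incidence matrix and `J` all ones, each block becomes an expression in `A`, `J` and `N`
(`eccMatrix_centralGraph`).

Since `N * Nᵀ = A + r`, a Schur complement followed by moving `Nᵀ` around the determinant reduces
the characteristic polynomial, up to powers of `t - 3`, to the determinant of a polynomial in `A`
minus a multiple of `J` (`det_fromBlocks_incidence`). The polynomial in `A` contributes one
quadratic in `t` per eigenvalue. As `G` is regular, the constants form an eigenvector, so the `J`
term alters only the quadratic at `λ₁ = r` (`det_sub_smul_allOnes`), turning it into the
characteristic polynomial of the quotient matrix. The bounds `-r ≤ λᵢ` and `2 ≤ p`, `r ≤ q` make the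
discriminants nonnegative. -/

@[simp]
lemma centralGraph_adj_inl_inl {u v : V} :
    (centralGraph G).Adj (Sum.inl u) (Sum.inl v) ↔ u ≠ v ∧ ¬ G.Adj u v := Iff.rfl

@[simp]
lemma centralGraph_adj_inl_inr {u : V} {e : G.edgeSet} :
    (centralGraph G).Adj (Sum.inl u) (Sum.inr e) ↔ u ∈ (e : Sym2 V) := Iff.rfl

@[simp]
lemma centralGraph_adj_inr_inl {u : V} {e : G.edgeSet} :
    (centralGraph G).Adj (Sum.inr e) (Sum.inl u) ↔ u ∈ (e : Sym2 V) := Iff.rfl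

@[simp]
lemma centralGraph_adj_inr_inr {e f : G.edgeSet} :
    ¬ (centralGraph G).Adj (Sum.inr e) (Sum.inr f) := fun h => h

lemma not_adj_of_adj_of_adj (htri : G.CliqueFree 3) {a b c : V} (hab : G.Adj a b)
    (hac : G.Adj a c) : ¬ G.Adj b c := by
  classical
  intro hbc
  exact htri {a, b, c} (is3Clique_triple_iff.2 ⟨hab, hac, hbc⟩)

lemma edist_le_two_of_adj_of_adj {W : Type*} {H : SimpleGraph W} {a b c : W} (hab : H.Adj a b)
    (hbc : H.Adj b c) : H.edist a c ≤ 2 :=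
  (Walk.cons hab (.cons hbc .nil)).edist_le

lemma edist_le_three_of_adj_of_adj_of_adj {W : Type*} {H : SimpleGraph W} {a b c d : W}
    (hab : H.Adj a b) (hbc : H.Adj b c) (hcd : H.Adj c d) : H.edist a d ≤ 3 :=
  (Walk.cons hab (.cons hbc (.cons hcd .nil))).edist_le

lemma edist_inl_inl_of_adj {u v : V} (h : G.Adj u v) :
    (centralGraph G).edist (Sum.inl u) (Sum.inl v) = 2 := by
  refine edist_eq_two_iff.2 ⟨by simpa using h.ne, by simp [h], Sum.inr ⟨s(u, v), h⟩, ?_⟩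
  simp [mem_commonNeighbors]

lemma edist_inl_inr_of_notMem (htri : G.CliqueFree 3) {u : V} {e : G.edgeSet}
    (h : u ∉ (e : Sym2 V)) : (centralGraph G).edist (Sum.inl u) (Sum.inr e) = 2 := by
  refine edist_eq_two_iff.2 ⟨by simp, by simpa using h, ?_⟩
  obtain ⟨⟨a, b⟩, hab⟩ := e
  have hab' : G.Adj a b := hab
  simp only [Sym2.mem_iff, not_or] at h
  -- Without triangles, `u` misses an end of `e`; that end is the midpoint.
  by_cases hua : G.Adj u a
  · refine ⟨Sum.inl b, ?_⟩
    simp only [mem_commonNeighbors, centralGraph_adj_inl_inl, centralGraph_adj_inr_inl]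
    exact ⟨⟨h.2, fun hub => not_adj_of_adj_of_adj htri hua hub hab'⟩, Sym2.mem_mk_right a b⟩
  · refine ⟨Sum.inl a, ?_⟩
    simp only [mem_commonNeighbors, centralGraph_adj_inl_inl, centralGraph_adj_inr_inl]
    exact ⟨⟨h.1, hua⟩, Sym2.mem_mk_left a b⟩

lemma edist_inr_inr_of_mem {e f : G.edgeSet} {v : V} (hef : e ≠ f) (he : v ∈ (e : Sym2 V))
    (hf : v ∈ (f : Sym2 V)) : (centralGraph G).edist (Sum.inr e) (Sum.inr f) = 2 :=
  edist_eq_two_iff.2 ⟨by simpa using hef, by simp, Sum.inl v, by simp [mem_commonNeighbors, he, hf]⟩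

lemma edist_inr_inr_of_disjoint (htri : G.CliqueFree 3) {e f : G.edgeSet}
    (h : ∀ v ∈ (e : Sym2 V), v ∉ (f : Sym2 V)) :
    (centralGraph G).edist (Sum.inr e) (Sum.inr f) = 3 := by
  refine le_antisymm ?_ ?_
  · obtain ⟨⟨a, b⟩, hab⟩ := e
    have ha : a ∉ (f : Sym2 V) := h a (Sym2.mem_mk_left a b)
    obtain ⟨⟨c, d⟩, hcd⟩ := f
    have hcd' : G.Adj c d := hcd
    simp only [Sym2.mem_iff, not_or] at ha
    -- Again `a` misses some end `x` of `f`, giving the path `e, a, x, f`.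
    have key : ∃ x ∈ s(c, d), a ≠ x ∧ ¬ G.Adj a x := by
      by_cases hac : G.Adj a c
      · exact ⟨d, by simp, ha.2, fun had => not_adj_of_adj_of_adj htri hac had hcd'⟩
      · exact ⟨c, by simp, ha.1, hac⟩
    obtain ⟨x, hx, hax⟩ := key
    exact edist_le_three_of_adj_of_adj_of_adj (b := Sum.inl a) (c := Sum.inl x)
      (Sym2.mem_mk_left a b) hax hx
  · have h2 : (2 : ℕ∞) < (centralGraph G).edist (Sum.inr e) (Sum.inr f) := by
      refine two_lt_edist_iff.2 ⟨?_, by simp, ?_⟩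
      · rintro ⟨⟩
        obtain ⟨⟨a, b⟩, hab⟩ := e
        exact h a (Sym2.mem_mk_left a b) (Sym2.mem_mk_left a b)
      · ext (v | g)
        · simpa [mem_commonNeighbors] using h v
        · simp [mem_commonNeighbors]
    have h3 := Order.add_one_le_of_lt h2
    rwa [show (2 : ℕ∞) + 1 = 3 from rfl] at h3

lemma edist_inl_le_two (htri : G.CliqueFree 3) (u : V) (w : V ⊕ G.edgeSet) :
    (centralGraph G).edist (Sum.inl u) w ≤ 2 := by
  rcases w with v | e
  · by_cases huv : u = v
    · simp [huv]
    · by_cases h : G.Adj u v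
      · exact (edist_inl_inl_of_adj h).le
      · rw [edist_eq_one_iff_adj.2 (centralGraph_adj_inl_inl.2 ⟨huv, h⟩)]
        exact one_le_two
  · by_cases h : u ∈ (e : Sym2 V)
    · rw [edist_eq_one_iff_adj.2 (centralGraph_adj_inl_inr.2 h)]
      exact one_le_two
    · exact (edist_inl_inr_of_notMem htri h).le

lemma edist_inr_le_three (htri : G.CliqueFree 3) (e : G.edgeSet) (w : V ⊕ G.edgeSet) :
    (centralGraph G).edist (Sum.inr e) w ≤ 3 := by
  rcases w with v | f
  · rw [edist_comm]
    exact (edist_inl_le_two htri v _).trans (by norm_num)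
  · by_cases h : ∀ v ∈ (e : Sym2 V), v ∉ (f : Sym2 V)
    · exact (edist_inr_inr_of_disjoint htri h).le
    · push Not at h
      obtain ⟨v, he, hf⟩ := h
      exact (edist_le_two_of_adj_of_adj (b := Sum.inl v) he hf).trans (by norm_num)

lemma centralGraph_connected [Nonempty V] (htri : G.CliqueFree 3) :
    (centralGraph G).Connected := by
  have : Nonempty (V ⊕ G.edgeSet) := inferInstance
  refine ⟨?_⟩
  rintro (u | e) w
  · exact edist_ne_top_iff_reachable.1 (ne_top_of_le_ne_top (by simp) (edist_inl_le_two htri u w))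
  · exact edist_ne_top_iff_reachable.1
      (ne_top_of_le_ne_top (by simp) (edist_inr_le_three htri e w))

/-! ### Eccentricities in the central graph. -/

variable [Fintype V] [DecidableRel G.Adj]

lemma exists_adj_ne (hr : 2 ≤ r) (hreg : G.IsRegularOfDegree r) (u v : V) :
    ∃ w, G.Adj u w ∧ w ≠ v := by
  classical
  have h : 1 < #(G.neighborFinset u) := by
    rw [card_neighborFinset_eq_degree, hreg.degree_eq]; omega
  obtain ⟨w, hw, hne⟩ := exists_mem_ne h v
  exact ⟨w, by simpa using hw, hne⟩

lemma eccent_inl (hr : 2 ≤ r) (hreg : G.IsRegularOfDegree r) (htri : G.CliqueFree 3) (u : V) :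
    (centralGraph G).eccent (Sum.inl u) = 2 := by
  refine le_antisymm ((eccent_le_iff _ _).2 (edist_inl_le_two htri u)) ?_
  obtain ⟨v, huv, -⟩ := exists_adj_ne hr hreg u u
  rw [← edist_inl_inl_of_adj huv]
  exact edist_le_eccent

/-- Minimum degree 2 extends `e = ab` to a walk `b, a, c, d` with `c ≠ b` and `d ≠ a`; `d = b` would
close a triangle, so `cd` avoids `ab`. -/
lemma exists_disjoint_edge (hr : 2 ≤ r) (hreg : G.IsRegularOfDegree r) (htri : G.CliqueFree 3)
    (e : G.edgeSet) : ∃ f : G.edgeSet, ∀ v ∈ (e : Sym2 V), v ∉ (f : Sym2 V) := by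
  obtain ⟨⟨a, b⟩, hab⟩ := e
  have hab' : G.Adj a b := hab
  obtain ⟨c, hac, hcb⟩ := exists_adj_ne hr hreg a b
  obtain ⟨d, hcd, hda⟩ := exists_adj_ne hr hreg c a
  refine ⟨⟨s(c, d), hcd⟩, fun v hv hv' => ?_⟩
  have hdb : d ≠ b := by
    rintro rfl
    exact not_adj_of_adj_of_adj htri hac hab' hcd
  have := hac.ne
  simp only [Sym2.mem_iff] at hv hv'
  grind

lemma eccent_inr (hr : 2 ≤ r) (hreg : G.IsRegularOfDegree r) (htri : G.CliqueFree 3)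
    (e : G.edgeSet) : (centralGraph G).eccent (Sum.inr e) = 3 := by
  refine le_antisymm ((eccent_le_iff _ _).2 (edist_inr_le_three htri e)) ?_
  obtain ⟨f, hf⟩ := exists_disjoint_edge hr hreg htri e
  rw [← edist_inr_inr_of_disjoint htri hf]
  exact edist_le_eccent

/-! ### The incidence matrix and the block form of the eccentricity matrix. -/

variable [DecidableEq V]

variable (G) in
/-- The vertex-edge incidence matrix, with its columns indexed by the edges. -/
noncomputable def edgeIncMatrix : Matrix V G.edgeSet ℝ :=
  (G.incMatrix ℝ).submatrix id Subtype.val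

lemma edgeIncMatrix_apply (v : V) (e : G.edgeSet) :
    edgeIncMatrix G v e = if v ∈ (e : Sym2 V) then 1 else 0 := by
  simp [edgeIncMatrix, incMatrix_apply', incidenceSet, e.2]

lemma edgeIncMatrix_mul_transpose (hreg : G.IsRegularOfDegree r) :
    edgeIncMatrix G * (edgeIncMatrix G)ᵀ = G.adjMatrix ℝ + (r : ℝ) • 1 := by
  ext u v
  have h := congrFun (congrFun (G.incMatrix_mul_transpose (R := ℝ)) u) v
  have h2 : (edgeIncMatrix G * (edgeIncMatrix G)ᵀ) u v =
      (G.incMatrix ℝ * (G.incMatrix ℝ)ᵀ) u v := by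
    simp only [mul_apply, transpose_apply, edgeIncMatrix, submatrix_apply, id]
    rw [← Finset.sum_subtype G.edgeFinset (p := (· ∈ G.edgeSet)) (fun e => mem_edgeFinset)
      (fun e => G.incMatrix ℝ u e * G.incMatrix ℝ v e)]
    refine Finset.sum_subset (subset_univ _) fun e _ he => ?_
    rw [G.incMatrix_of_notMem_incidenceSet (fun h => he (mem_edgeFinset.2 h.1)), zero_mul]
  rw [h2, h]
  by_cases huv : u = v
  · simp [huv, hreg.degree_eq]
  · simp [huv, adjMatrix_apply]

lemma sum_edgeIncMatrix_col (e : G.edgeSet) : ∑ v, edgeIncMatrix G v e = 2 :=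
  G.sum_incMatrix_apply_of_mem_edgeSet e.2

lemma sum_edgeIncMatrix_row (hreg : G.IsRegularOfDegree r) (v : V) :
    ∑ e, edgeIncMatrix G v e = r := by
  -- Column sums are 2, so a row sum of `N * Nᵀ = A + r`, which is `2 * r`, is twice the row sum of
  -- `N`.
  have h : ∑ e : G.edgeSet, (∑ w, edgeIncMatrix G w e) * edgeIncMatrix G v e =
      ∑ w, (edgeIncMatrix G * (edgeIncMatrix G)ᵀ) v w := by
    simp only [mul_apply, transpose_apply, sum_mul]
    rw [sum_comm]
    simp only [mul_comm]
  simp only [sum_edgeIncMatrix_col, ← mul_sum, edgeIncMatrix_mul_transpose hreg] at h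
  simp only [Matrix.add_apply, Matrix.smul_apply, one_apply, sum_add_distrib, adjMatrix_apply,
    sum_boole, smul_eq_mul, mul_ite, mul_one, mul_zero, sum_ite_eq, mem_univ, if_true] at h
  have h' : #{w | G.Adj v w} = r := by
    rw [← hreg.degree_eq v, ← card_neighborFinset_eq_degree, neighborFinset_eq_filter]
  rw [h'] at h
  linarith

/-- The entry counts common ends, and two common ends would force `e = f`. -/
lemma transpose_mul_edgeIncMatrix_apply (e f : G.edgeSet) :
    ((edgeIncMatrix G)ᵀ * edgeIncMatrix G) e f =
      if e = f then 2 else if ∀ v ∈ (e : Sym2 V), v ∉ (f : Sym2 V) then 0 else 1 := by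
  have key : ((edgeIncMatrix G)ᵀ * edgeIncMatrix G) e f =
      #{v | v ∈ (e : Sym2 V) ∧ v ∈ (f : Sym2 V)} := by
    simp only [mul_apply, transpose_apply, edgeIncMatrix_apply, ite_zero_mul_ite_zero, mul_one,
      sum_boole]
  rw [key]
  split_ifs with hef h
  · subst hef
    obtain ⟨⟨a, b⟩, hab⟩ := e
    have hab' : G.Adj a b := hab
    have : ({v | v ∈ s(a, b) ∧ v ∈ s(a, b)} : Finset V) = {a, b} := by
      ext; simp
    rw [show (#{v | v ∈ s(a, b) ∧ v ∈ s(a, b)}) = 2 by rw [this, card_pair hab'.ne]]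
    norm_num
  · rw [Finset.filter_eq_empty_iff.2 fun v _ hv => h v hv.1 hv.2]
    simp
  · push Not at h
    obtain ⟨v, he, hf⟩ := h
    have : ({v | v ∈ (e : Sym2 V) ∧ v ∈ (f : Sym2 V)} : Finset V) = {v} := by
      refine Finset.eq_singleton_iff_unique_mem.2 ⟨by simp [he, hf], fun w hw => ?_⟩
      by_contra hwv
      simp only [mem_filter, mem_univ, true_and] at hw
      have h1 := (Sym2.mem_and_mem_iff hwv).1 ⟨hw.1, he⟩
      have h2 := (Sym2.mem_and_mem_iff hwv).1 ⟨hw.2, hf⟩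
      exact hef (Subtype.ext (h1.trans h2.symm))
    rw [this]
    simp

/-- The square all-ones matrix. -/
def allOnes (n : Type*) : Matrix n n ℝ := Matrix.of fun _ _ => 1

lemma eccMatrix_centralGraph_inl_inl (hr : 2 ≤ r) (hreg : G.IsRegularOfDegree r)
    (htri : G.CliqueFree 3) (u v : V) :
    eccMatrix (centralGraph G) (Sum.inl u) (Sum.inl v) = 2 * G.adjMatrix ℝ u v := by
  rw [eccMatrix, of_apply, eccent_inl hr hreg htri, eccent_inl hr hreg htri, min_self,
    adjMatrix_apply]
  by_cases h : G.Adj u v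
  · simp [h, SimpleGraph.dist, edist_inl_inl_of_adj h]
  · rw [if_neg, if_neg h, mul_zero]
    rintro h2
    obtain ⟨hne, hadj, -⟩ := edist_eq_two_iff.1 h2
    exact hadj ⟨fun huv => hne (congrArg _ huv), h⟩

lemma eccMatrix_centralGraph_inl_inr (hr : 2 ≤ r) (hreg : G.IsRegularOfDegree r)
    (htri : G.CliqueFree 3) (u : V) (e : G.edgeSet) :
    eccMatrix (centralGraph G) (Sum.inl u) (Sum.inr e) = 2 - 2 * edgeIncMatrix G u e := by
  rw [eccMatrix, of_apply, eccent_inl hr hreg htri, eccent_inr hr hreg htri,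
    min_eq_left (by norm_num), edgeIncMatrix_apply]
  by_cases h : u ∈ (e : Sym2 V)
  · rw [if_neg, if_pos h]
    · norm_num
    · exact fun h2 => (edist_eq_two_iff.1 h2).2.1 h
  · simp [h, SimpleGraph.dist, edist_inl_inr_of_notMem htri h]

lemma eccMatrix_comm {W : Type*} (H : SimpleGraph W) (u v : W) :
    eccMatrix H u v = eccMatrix H v u := by
  simp only [eccMatrix, of_apply, H.edist_comm (u := u), H.dist_comm (u := u),
    min_comm (H.eccent u)]

lemma eccMatrix_centralGraph_inr_inr (hr : 2 ≤ r) (hreg : G.IsRegularOfDegree r)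
    (htri : G.CliqueFree 3) (e f : G.edgeSet) :
    eccMatrix (centralGraph G) (Sum.inr e) (Sum.inr f) =
      3 + 3 * (1 : Matrix G.edgeSet G.edgeSet ℝ) e f -
        3 * ((edgeIncMatrix G)ᵀ * edgeIncMatrix G) e f := by
  rw [eccMatrix, of_apply, eccent_inr hr hreg htri, eccent_inr hr hreg htri, min_self,
    transpose_mul_edgeIncMatrix_apply]
  by_cases hef : e = f
  · subst hef
    norm_num
  · simp only [hef, if_false, one_apply]
    by_cases h : ∀ v ∈ (e : Sym2 V), v ∉ (f : Sym2 V)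
    · rw [if_pos (edist_inr_inr_of_disjoint htri h), if_pos h]
      simp [SimpleGraph.dist, edist_inr_inr_of_disjoint htri h]
    · rw [if_neg h, if_neg]
      · norm_num
      · push Not at h
        obtain ⟨v, he, hf⟩ := h
        rw [edist_inr_inr_of_mem hef he hf]
        norm_num

lemma allOnes_mul_edgeIncMatrix_apply (v : V) (e : G.edgeSet) :
    (allOnes V * edgeIncMatrix G) v e = 2 := by
  simp [allOnes, mul_apply, sum_edgeIncMatrix_col]

/-- All-ones blocks are absorbed between incidence factors, so that `N` can later meet `Nᵀ`: `J * N`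
has all entries 2 and `Nᵀ * J * N` all entries 4, whence the coefficient `3 / 4`. -/
lemma eccMatrix_centralGraph (hr : 2 ≤ r) (hreg : G.IsRegularOfDegree r)
    (htri : G.CliqueFree 3) :
    eccMatrix (centralGraph G) =
      fromBlocks ((2 : ℝ) • G.adjMatrix ℝ) ((allOnes V - (2 : ℝ) • 1) * edgeIncMatrix G)
        ((edgeIncMatrix G)ᵀ * (allOnes V - (2 : ℝ) • 1))
        ((3 : ℝ) • 1 +
          (edgeIncMatrix G)ᵀ * ((3 / 4 : ℝ) • allOnes V - (3 : ℝ) • 1) * edgeIncMatrix G) := by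
  have hB (u : V) (e : G.edgeSet) : eccMatrix (centralGraph G) (Sum.inl u) (Sum.inr e) =
      ((allOnes V - (2 : ℝ) • 1) * edgeIncMatrix G : Matrix V G.edgeSet ℝ) u e := by
    rw [eccMatrix_centralGraph_inl_inr hr hreg htri, Matrix.sub_mul, Matrix.sub_apply,
      allOnes_mul_edgeIncMatrix_apply]
    simp
  have hJ : (allOnes V)ᵀ = allOnes V := rfl
  ext (u | e) (v | f)
  · rw [eccMatrix_centralGraph_inl_inl hr hreg htri]
    simp
  · exact hB u f
  · rw [eccMatrix_comm, hB, fromBlocks_apply₂₁, ← transpose_apply (_ * _), transpose_mul]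
    simp [hJ]
  · rw [eccMatrix_centralGraph_inr_inr hr hreg htri, fromBlocks_apply₂₂]
    have h : ((edgeIncMatrix G)ᵀ * (allOnes V * edgeIncMatrix G)) e f = 4 := by
      simp only [mul_apply (M := (edgeIncMatrix G)ᵀ), allOnes_mul_edgeIncMatrix_apply,
        transpose_apply, ← sum_mul, sum_edgeIncMatrix_col]
      norm_num
    simp only [Matrix.mul_sub, Matrix.sub_mul, Matrix.mul_smul, Matrix.smul_mul, Matrix.mul_assoc,
      Matrix.one_mul, Matrix.add_apply, Matrix.sub_apply, Matrix.smul_apply, h, smul_eq_mul]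
    ring

end Graph
-- Determinant identities.
section LinearAlgebra

variable {n m : Type*} [Fintype n] [DecidableEq n] [Fintype m] [DecidableEq m]

lemma allOnes_mul_allOnes : allOnes n * allOnes n = (Fintype.card n : ℝ) • allOnes n := by
  ext
  simp [allOnes, mul_apply]

lemma det_one_sub_smul_allOnes (c : ℝ) :
    (1 - c • allOnes n).det = 1 - c * Fintype.card n := by
  have h : 1 - c • allOnes n =
      1 + replicateCol Unit (fun _ : n => -c) * replicateRow Unit (fun _ : n => (1 : ℝ)) := by
    ext i j
    simp [allOnes, mul_apply, sub_eq_add_neg]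
  rw [h, det_one_add_replicateCol_mul_replicateRow]
  simp [dotProduct, mul_comm, sub_eq_add_neg]

/-- A determinant for a rank one perturbation along an eigenvector of constants. -/
lemma det_sub_smul_allOnes {F : Matrix n n ℝ} {φ : ℝ} (hφ : φ ≠ 0)
    (hF : F * allOnes n = φ • allOnes n) (k : ℝ) :
    (F - k • allOnes n).det * φ = F.det * (φ - k * Fintype.card n) := by
  have h : F - k • allOnes n = F * (1 - (k / φ) • allOnes n) := by
    rw [Matrix.mul_sub, Matrix.mul_one, Matrix.mul_smul, hF, smul_smul, div_mul_cancel₀ _ hφ]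
  rw [h, det_mul, det_one_sub_smul_allOnes]
  field_simp

lemma det_smul_one_sub_mul_comm (B : Matrix n m ℝ) (C : Matrix m n ℝ) (s : ℝ) :
    s ^ Fintype.card n * (s • 1 - C * B).det = s ^ Fintype.card m * (s • 1 - B * C).det := by
  have h := congrArg (eval s) (charpoly_mul_comm' C B)
  simpa [eval_charpoly, scalar_apply, ← smul_one_eq_diagonal] using h

lemma det_aeval_eq_prod {A : Matrix n n ℝ} (hA : A.IsHermitian) (f : ℝ[X]) :
    (aeval A f).det = ∏ i, f.eval (hA.eigenvalues i) := by
  have h : aeval A f = Unitary.conjStarAlgAut ℝ _ hA.eigenvectorUnitary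
      (aeval (diagonal hA.eigenvalues) f) := by
    conv_lhs => rw [hA.spectral_theorem]
    exact aeval_algHom_apply
      ((Unitary.conjStarAlgAut ℝ (Matrix n n ℝ) hA.eigenvectorUnitary).toAlgEquiv :
        Matrix n n ℝ →ₐ[ℝ] Matrix n n ℝ) _ f
  have h2 : aeval (diagonal hA.eigenvalues) f = diagonal fun i => f.eval (hA.eigenvalues i) := by
    have := aeval_algHom_apply (diagonalAlgHom ℝ : (n → ℝ) →ₐ[ℝ] Matrix n n ℝ) hA.eigenvalues f
    refine (this.trans (congrArg _ ?_))
    ext i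
    simp
  rw [h, h2, Unitary.conjStarAlgAut_apply, det_mul_right_comm]
  simp

/-- Transfers the spectral formula to any listing of the eigenvalues, as both listings are the root
multiset of `A.charpoly`. -/
lemma det_aeval_eq_prod_of_charpoly {A : Matrix n n ℝ} (hA : A.IsHermitian) {ι : Type*}
    {s : Finset ι} {lam : ι → ℝ} (h : A.charpoly = ∏ i ∈ s, (X - C (lam i))) (f : ℝ[X]) :
    (aeval A f).det = ∏ i ∈ s, f.eval (lam i) := by
  have h1 : univ.val.map hA.eigenvalues = s.val.map lam := by
    have h2 := hA.roots_charpoly_eq_eigenvalues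
    rw [h, roots_prod _ _ (prod_ne_zero_iff.2 fun i _ => X_sub_C_ne_zero _)] at h2
    simpa using h2.symm
  rw [det_aeval_eq_prod hA]
  have h2 := congrArg (fun t : Multiset ℝ => (t.map fun x => f.eval x).prod) h1
  simpa using h2

/-- The characteristic determinant of a block matrix built from `A`, the all-ones matrix and a
matrix `N` with `N * Nᵀ = A + r`, evaluated outside the exceptional points. -/
lemma det_fromBlocks_incidence {A : Matrix n n ℝ} {N : Matrix n m ℝ} {r t c : ℝ}
    (hAJ : A * allOnes n = r • allOnes n) (hJA : allOnes n * A = r • allOnes n)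
    (hN : N * Nᵀ = A + r • 1) (hP : (t • 1 - (2 : ℝ) • A).det ≠ 0)
    (hc : c = 3 * t / 4 - 3 * r / 2 + Fintype.card n - 4) :
    (t - 3) ^ Fintype.card n *
      (t • 1 - fromBlocks ((2 : ℝ) • A) ((allOnes n - (2 : ℝ) • 1) * N)
        (Nᵀ * (allOnes n - (2 : ℝ) • 1))
        ((3 : ℝ) • 1 + Nᵀ * ((3 / 4 : ℝ) • allOnes n - (3 : ℝ) • 1) * N)).det =
    (t - 3) ^ Fintype.card m *
      ((t - 3) • (t • 1 - (2 : ℝ) • A) + ((3 * t - 4) • 1 - (6 : ℝ) • A) * (A + r • 1) -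
        (2 * r * c) • allOnes n).det := by
  set J := allOnes n with hJ
  set P := t • 1 - (2 : ℝ) • A with hPdef
  set B := J - (2 : ℝ) • (1 : Matrix n n ℝ) with hB
  set E := (3 / 4 : ℝ) • J - (3 : ℝ) • (1 : Matrix n n ℝ) with hE
  have hJJ : J * J = (Fintype.card n : ℝ) • J := allOnes_mul_allOnes
  let _ : Invertible P := invertibleOfIsUnitDet P (isUnit_iff_ne_zero.2 hP)
  have hPB : P * B = B * P := by
    simp only [hPdef, hB, Matrix.mul_sub, Matrix.sub_mul, Matrix.smul_mul, Matrix.mul_smul, hAJ,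
      hJA, Matrix.one_mul, Matrix.mul_one]
    module
  have hblock : t • 1 - fromBlocks ((2 : ℝ) • A) (B * N) (Nᵀ * B) ((3 : ℝ) • 1 + Nᵀ * E * N) =
      fromBlocks P (-(B * N)) (-(Nᵀ * B)) ((t - 3) • 1 - Nᵀ * E * N) := by
    rw [← fromBlocks_one, fromBlocks_smul, sub_eq_add_neg, fromBlocks_neg, fromBlocks_add]
    simp only [hPdef]
    congr 1
    · simp
    · simp
    · rw [sub_smul]
      abel
  have hschur : (t - 3) • (1 : Matrix m m ℝ) - Nᵀ * E * N - -(Nᵀ * B) * ⅟P * -(B * N) =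
      (t - 3) • 1 - Nᵀ * ((E + B * ⅟P * B) * N) := by
    simp only [Matrix.neg_mul, Matrix.mul_neg, neg_neg, Matrix.add_mul, Matrix.mul_add,
      Matrix.mul_assoc]
    abel
  -- Moving `Nᵀ` to the other end creates `N * Nᵀ`; multiplying by `det P` then clears `⅟P`, since
  -- `P` commutes with `B`.
  rw [hblock, det_fromBlocks₁₁, hschur, mul_left_comm, det_smul_one_sub_mul_comm, mul_left_comm,
    ← det_mul]
  congr 2
  have h1 : P * (B * ⅟P * B) = B * B := by
    rw [← Matrix.mul_assoc, ← Matrix.mul_assoc, hPB, Matrix.mul_assoc B P, mul_invOf_self,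
      Matrix.mul_one]
  have h2 : P * E + B * B = c • J + ((4 - 3 * t) • 1 + (6 : ℝ) • A) := by
    simp only [hPdef, hB, hE, Matrix.mul_sub, Matrix.sub_mul, Matrix.smul_mul, Matrix.mul_smul,
      hAJ, hJJ, Matrix.one_mul, Matrix.mul_one, hc]
    module
  rw [Matrix.mul_assoc _ N, hN, Matrix.mul_sub, ← Matrix.mul_assoc, Matrix.mul_add P, h1, h2,
    Matrix.add_mul]
  simp only [Matrix.mul_add, Matrix.add_mul, Matrix.sub_mul, Matrix.smul_mul, Matrix.mul_smul, hJA,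
    Matrix.mul_one, Matrix.one_mul]
  module

end LinearAlgebra

lemma quadratic_ne_zero (b c : ℝ) : (X ^ 2 - C b * X + C c : ℝ[X]) ≠ 0 := fun h => by
  have := congrArg (fun f => coeff f 2) h
  simp at this

lemma roots_quadratic {b c D : ℝ} (hD : D = b ^ 2 - 4 * c) (h0 : 0 ≤ D) :
    (X ^ 2 - C b * X + C c).roots = {(b + √D) / 2, (b - √D) / 2} := by
  have hs := Real.mul_self_sqrt h0
  have h : X ^ 2 - C b * X + C c = (X - C ((b + √D) / 2)) * (X - C ((b - √D) / 2)) := by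
    have h1 : b = (b + √D) / 2 + (b - √D) / 2 := by ring
    have h2 : c = (b + √D) / 2 * ((b - √D) / 2) := by linarith
    conv_lhs => rw [h2]; enter [1, 2, 1]; rw [h1]
    simp only [C_add, C_mul]
    ring
  rw [h, roots_mul (mul_ne_zero (X_sub_C_ne_zero _) (X_sub_C_ne_zero _))]
  simp [Multiset.singleton_add]

/-! ### The adjacency spectrum and the characteristic polynomial. -/

section Regular

variable {V : Type*} [Fintype V] [DecidableEq V] {G : SimpleGraph V} [DecidableRel G.Adj] {r : ℕ}

lemma adjMatrix_mul_allOnes (hreg : G.IsRegularOfDegree r) :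
    G.adjMatrix ℝ * allOnes V = (r : ℝ) • allOnes V := by
  ext u v
  simp [allOnes, hreg.degree_eq]

lemma allOnes_mul_adjMatrix (hreg : G.IsRegularOfDegree r) :
    allOnes V * G.adjMatrix ℝ = (r : ℝ) • allOnes V := by
  ext u v
  simp [allOnes, hreg.degree_eq]

lemma two_mul_card_edgeFinset (hreg : G.IsRegularOfDegree r) :
    Fintype.card V * r = 2 * #G.edgeFinset := by
  rw [← sum_degrees_eq_twice_card_edges]
  simp [hreg.degree_eq]

lemma exists_eigenvector_of_isRoot_charpoly {n : Type*} [Fintype n] [DecidableEq n]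
    {A : Matrix n n ℝ} {μ : ℝ} (h : A.charpoly.IsRoot μ) : ∃ v ≠ 0, A *ᵥ v = μ • v := by
  rw [IsRoot, eval_charpoly, scalar_apply, ← smul_one_eq_diagonal,
    ← exists_mulVec_eq_zero_iff] at h
  obtain ⟨v, hv, h⟩ := h
  refine ⟨v, hv, ?_⟩
  rw [sub_mulVec, smul_mulVec, one_mulVec, sub_eq_zero] at h
  exact h.symm

lemma isRoot_charpoly_adjMatrix [Nonempty V] (hreg : G.IsRegularOfDegree r) :
    (G.adjMatrix ℝ).charpoly.IsRoot r := by
  rw [IsRoot, eval_charpoly, scalar_apply, ← smul_one_eq_diagonal, ← exists_mulVec_eq_zero_iff]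
  refine ⟨fun _ => 1, fun h => one_ne_zero (congrFun h (Classical.arbitrary V)), ?_⟩
  ext v
  simp [sub_mulVec, smul_mulVec, hreg.degree_eq, adjMatrix_mulVec_apply]

/-- The Laplacian `r - A` is positive semidefinite. -/
lemma le_of_isRoot_charpoly_adjMatrix (hreg : G.IsRegularOfDegree r) {μ : ℝ}
    (h : (G.adjMatrix ℝ).charpoly.IsRoot μ) : μ ≤ r := by
  obtain ⟨v, hv, h⟩ := exists_eigenvector_of_isRoot_charpoly h
  have h1 := (posSemidef_lapMatrix ℝ G).dotProduct_mulVec_nonneg v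
  have h2 : G.lapMatrix ℝ *ᵥ v = ((r : ℝ) - μ) • v := by
    rw [lapMatrix, sub_mulVec, h, sub_smul]
    congr 1
    ext i
    simp [degMatrix_mulVec_apply, hreg.degree_eq]
  rw [h2, star_trivial, dotProduct_smul, smul_eq_mul] at h1
  have h3 : 0 < v ⬝ᵥ v := by simpa using dotProduct_star_self_pos_iff.2 hv
  nlinarith

/-- The matrix `A + r = N * Nᵀ` is positive semidefinite. -/
lemma neg_le_of_isRoot_charpoly_adjMatrix (hreg : G.IsRegularOfDegree r) {μ : ℝ}
    (h : (G.adjMatrix ℝ).charpoly.IsRoot μ) : 0 ≤ μ + r := by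
  obtain ⟨v, hv, h⟩ := exists_eigenvector_of_isRoot_charpoly h
  have h1 : 0 ≤ v ⬝ᵥ (edgeIncMatrix G * (edgeIncMatrix G)ᵀ) *ᵥ v := by
    rw [← mulVec_mulVec, dotProduct_mulVec, ← mulVec_transpose]
    simpa using dotProduct_star_self_nonneg ((edgeIncMatrix G)ᵀ *ᵥ v)
  rw [edgeIncMatrix_mul_transpose hreg, add_mulVec, h, smul_mulVec, one_mulVec, ← add_smul,
    dotProduct_smul, smul_eq_mul] at h1
  have h3 : 0 < v ⬝ᵥ v := by simpa using dotProduct_star_self_pos_iff.2 hv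
  exact nonneg_of_mul_nonneg_left h1 h3

/-- The characteristic polynomial of the eccentricity matrix of the central graph. -/
lemma charpoly_eccMatrix_centralGraph (hr : 2 ≤ r) (hreg : G.IsRegularOfDegree r)
    (htri : G.CliqueFree 3) {ι : Type*} [DecidableEq ι] {s : Finset ι} {i₀ : ι} (hi₀ : i₀ ∉ s)
    {lam : ι → ℝ} (hlam : lam i₀ = r)
    (hspec : (G.adjMatrix ℝ).charpoly = ∏ i ∈ insert i₀ s, (X - C (lam i)))
    {p q : ℕ} (hp : Fintype.card V = p) (hq : #G.edgeFinset = q) (hpq : p ≤ q) :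
    (eccMatrix (centralGraph G)).charpoly =
      (X - C 3) ^ (q - p) *
      (∏ i ∈ s, (X ^ 2 - C (3 - (3 * r + lam i)) * X +
        C (6 * lam i - (4 + 6 * lam i) * (lam i + r)))) *
      (X ^ 2 - C (3 * q - 4 * r + 3 : ℝ) * X +
        C (6 * r * (q - 2 * r + 1) - 4 * (q - r) * (p - 2) : ℝ)) := by
  set A := G.adjMatrix ℝ with hA
  set F : ι → ℝ[X] := fun i => X ^ 2 - C (3 - (3 * r + lam i)) * X +
        C (6 * lam i - (4 + 6 * lam i) * (lam i + r)) with hF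
  set g : ℝ[X] := X ^ 2 - C (3 * q - 4 * r + 3 : ℝ) * X +
        C (6 * r * (q - 2 * r + 1) - 4 * (q - r) * (p - 2) : ℝ) with hg
  have hAH : A.IsHermitian := G.isHermitian_adjMatrix ℝ
  have h2q : (p : ℝ) * r = 2 * q := by
    rw [← hp, ← hq]; exact_mod_cast two_mul_card_edgeFinset hreg
  have hF0 : ∀ i, F i ≠ 0 := fun i => quadratic_ne_zero _ _
  have hcardE : Fintype.card G.edgeSet = q := by rw [← hq, edgeFinset_card]
  -- `bad` vanishes where `t - 2A` is singular or the quadratic at `r` is zero. Multiplying by it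
  -- makes the identity trivial at those points; being nonzero, it cancels afterwards.
  set bad : ℝ[X] := F i₀ * ∏ i ∈ insert i₀ s, (X - C (2 * lam i)) with hbad
  have hbad0 : bad ≠ 0 := mul_ne_zero (hF0 _) (prod_ne_zero_iff.2 fun i _ => X_sub_C_ne_zero _)
  have key : (X - C 3) ^ p * (eccMatrix (centralGraph G)).charpoly * bad =
      (X - C 3) ^ q * ((∏ i ∈ s, F i) * g) * bad := by
    refine Polynomial.funext fun t => ?_
    by_cases hb : bad.eval t = 0
    · simp only [eval_mul, hb, mul_zero]
    simp only [hbad, eval_mul, eval_prod, mul_eq_zero, not_or, eval_sub, eval_X, eval_C] at hb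
    obtain ⟨hφ, hP⟩ := hb
    have hP' : (t • 1 - (2 : ℝ) • A).det ≠ 0 := by
      have h := det_aeval_eq_prod_of_charpoly hAH hspec (C t - C 2 * X)
      simp only [map_sub, map_mul, aeval_C, aeval_X, Algebra.algebraMap_eq_smul_one,
        Matrix.smul_mul, Matrix.one_mul, eval_sub, eval_mul, eval_C, eval_X] at h
      rwa [h]
    set M := (t - 3) • (t • 1 - (2 : ℝ) • A) +
      ((3 * t - 4) • 1 - (6 : ℝ) • A) * (A + (r : ℝ) • 1) with hM
    have hMdet : M.det = ∏ i ∈ insert i₀ s, (F i).eval t := by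
      have h := det_aeval_eq_prod_of_charpoly hAH hspec
        (C (t - 3) * (C t - C 2 * X) + (C (3 * t - 4) - C 6 * X) * (X + C (r : ℝ)))
      have hMf : M = aeval A
          (C (t - 3) * (C t - C 2 * X) + (C (3 * t - 4) - C 6 * X) * (X + C (r : ℝ))) := by
        rw [map_add (aeval (R := ℝ) A), map_mul (aeval (R := ℝ) A), map_mul (aeval (R := ℝ) A), map_sub (aeval (R := ℝ) A),
          map_sub (aeval (R := ℝ) A), map_add (aeval (R := ℝ) A), map_mul (aeval (R := ℝ) A), map_mul (aeval (R := ℝ) A)]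
        simp only [aeval_C, aeval_X, Algebra.algebraMap_eq_smul_one, Matrix.smul_mul,
          Matrix.one_mul, hM]
      rw [hMf, h]
      refine prod_congr rfl fun i _ => ?_
      simp only [hF, eval_add, eval_sub, eval_mul, eval_C, eval_X, eval_pow]
      ring
    have hMJ : M * allOnes V = (F i₀).eval t • allOnes V := by
      have hAJ : A * allOnes V = (r : ℝ) • allOnes V := adjMatrix_mul_allOnes hreg
      simp only [hM, hF, hlam, Matrix.add_mul, Matrix.sub_mul, Matrix.smul_mul, Matrix.mul_assoc,
        Matrix.one_mul, hAJ, Matrix.mul_add, Matrix.mul_smul, eval_add, eval_sub, eval_mul, eval_C,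
        eval_X, eval_pow]
      module
    have h1 := det_fromBlocks_incidence (m := G.edgeSet) (adjMatrix_mul_allOnes hreg)
      (allOnes_mul_adjMatrix hreg) (edgeIncMatrix_mul_transpose hreg) hP' rfl
    have h2 := det_sub_smul_allOnes hφ hMJ
      (2 * r * (3 * t / 4 - 3 * r / 2 + Fintype.card V - 4))
    rw [← eccMatrix_centralGraph hr hreg htri, hcardE, hp] at h1
    rw [hp, hMdet, prod_insert hi₀] at h2
    -- The rank-one correction turns `F i₀` into the quotient quadratic, by `p * r = 2 * q`.
    have hgt : g.eval t = (F i₀).eval t - 2 * r * (3 * t / 4 - 3 * r / 2 + p - 4) * p := by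
      simp only [hg, hF, hlam, eval_add, eval_sub, eval_mul, eval_C, eval_X, eval_pow]
      linear_combination (3 * t / 2 - 3 * r + 2 * p - 4) * h2q
    have h3 := mul_left_cancel₀ hφ
      ((mul_comm _ _).trans (h2.trans (by rw [← hgt, mul_assoc])) :
        _ = _ * ((∏ i ∈ s, (F i).eval t) * g.eval t))
    rw [eval_mul, eval_mul (q := bad)]
    congr 1
    rw [eval_mul, eval_mul, eval_mul, eval_charpoly, scalar_apply, ← smul_one_eq_diagonal]
    simp only [eval_pow, eval_sub, eval_X, eval_C, eval_prod]
    rw [h1, ← h3]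
  have key2 := mul_right_cancel₀ hbad0 key
  rw [← Nat.add_sub_cancel' hpq, pow_add, mul_assoc] at key2
  rw [mul_left_cancel₀ (pow_ne_zero _ (X_sub_C_ne_zero _)) key2, mul_assoc]

end Regular

/-! ### The equitable partition. -/

lemma isEquitableQuotient_eccMatrix_centralGraph {V : Type*} [Fintype V] [DecidableEq V]
    [Nonempty V] {G : SimpleGraph V} [DecidableRel G.Adj] {p q r : ℕ}
    (hp : Fintype.card V = p) (hq : #G.edgeFinset = q) (hr : 2 ≤ r)
    (hreg : G.IsRegularOfDegree r) (htri : G.CliqueFree 3) :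
    IsEquitableQuotient (eccMatrix (centralGraph G)) (Sum.elim (fun _ => 0) (fun _ => 1))
      !![2 * (r : ℝ), 2 * ((q : ℝ) - r); 2 * ((p : ℝ) - 2), 3 * ((q : ℝ) - 2 * r + 1)] := by
  have hcardE : Fintype.card G.edgeSet = q := by rw [← hq, edgeFinset_card]
  refine ⟨fun k => ?_, ?_⟩
  · obtain ⟨u⟩ := ‹Nonempty V›
    obtain ⟨v, huv, -⟩ := exists_adj_ne hr hreg u u
    fin_cases k
    · exact ⟨Sum.inl u, rfl⟩
    · exact ⟨Sum.inr ⟨s(u, v), huv⟩, rfl⟩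
  · rintro (u | e) k <;> rw [sum_filter, Fintype.sum_sum_type] <;> fin_cases k
    · simp [eccMatrix_centralGraph_inl_inl hr hreg htri, sum_ite, ← neighborFinset_eq_filter,
        hreg.degree_eq, mul_comm]
    · simp only [Sum.elim_inl, Sum.elim_inr]
      simp [eccMatrix_centralGraph_inl_inr hr hreg htri, ← mul_sum, sum_edgeIncMatrix_row hreg,
        hcardE]
      ring
    · simp [eccMatrix_comm (centralGraph G) (Sum.inr e),
        eccMatrix_centralGraph_inl_inr hr hreg htri, ← mul_sum, sum_edgeIncMatrix_col, hp]
      ring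
    -- Each of the two ends of `e` lies on `r` edges.
    · have h : ∑ f, ((edgeIncMatrix G)ᵀ * edgeIncMatrix G) e f = 2 * r := by
        simp only [mul_apply, transpose_apply]
        rw [sum_comm]
        simp only [← mul_sum, ← sum_mul, sum_edgeIncMatrix_row hreg, sum_edgeIncMatrix_col]
      have h1 : ∑ f, (1 : Matrix G.edgeSet G.edgeSet ℝ) e f = 1 := by simp [one_apply]
      simp [eccMatrix_centralGraph_inr_inr hr hreg htri, sum_add_distrib, ← mul_sum, h, h1, hcardE]
      ring

end EccSpec

/-! ### Assembly of the spectrum. -/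

theorem theorem3p1 {V : Type*} [Fintype V] [DecidableEq V] [Nonempty V]
    (G : SimpleGraph V) [DecidableRel G.Adj] (p q r : ℕ)
    (hp : Fintype.card V = p) (hq : #G.edgeFinset = q)
    (hr : 2 ≤ r) (hreg : G.IsRegularOfDegree r) (htri : G.CliqueFree 3)
    (lam : ℕ → ℝ) (hlam : AntitoneOn lam (Set.Icc 1 p))
    (hspec : (G.adjMatrix ℝ).charpoly = ∏ i ∈ Finset.Icc 1 p, (X - C (lam i))) :
    (EccSpec.centralGraph G).Connected ∧
    lam 1 = r ∧
    EccSpec.eccSpectrum (EccSpec.centralGraph G) =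
      Multiset.replicate (q - p) (3 : ℝ) +
      ∑ i ∈ Finset.Icc 2 p,
        ({((3 - (3 * r + lam i)) +
            √((5 * lam i + 3 * (r - 1)) ^ 2 + 16 * (lam i + r))) / 2,
          ((3 - (3 * r + lam i)) -
            √((5 * lam i + 3 * (r - 1)) ^ 2 + 16 * (lam i + r))) / 2} : Multiset ℝ) +
      ({((3 * q - 4 * r + 3) +
          √((3 * q - 8 * r + 3) ^ 2 + 16 * (p - 2) * (q - r))) / 2,
        ((3 * q - 4 * r + 3) -
          √((3 * q - 8 * r + 3) ^ 2 + 16 * (p - 2) * (q - r))) / 2} : Multiset ℝ) ∧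
    ∃ Q : Matrix (Fin 2) (Fin 2) ℝ,
      Q = !![2 * (r : ℝ), 2 * ((q : ℝ) - r); 2 * ((p : ℝ) - 2), 3 * ((q : ℝ) - 2 * r + 1)] ∧
      EccSpec.IsEquitableQuotient (EccSpec.eccMatrix (EccSpec.centralGraph G))
        (Sum.elim (fun _ => 0) (fun _ => 1)) Q ∧
      Q.charpoly.roots =
        {((3 * q - 4 * r + 3) +
          √((3 * q - 8 * r + 3) ^ 2 + 16 * (p - 2) * (q - r))) / 2,
        ((3 * q - 4 * r + 3) -
          √((3 * q - 8 * r + 3) ^ 2 + 16 * (p - 2) * (q - r))) / 2} := by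
  have hrp : r < p := by
    have h := G.degree_lt_card_verts (Classical.arbitrary V)
    rwa [hreg.degree_eq, hp] at h
  have h2q : p * r = 2 * q := by rw [← hp, ← hq, EccSpec.two_mul_card_edgeFinset hreg]
  -- From `p * r = 2 * q` and `2 ≤ r`; thus `q - p` is not truncated.
  have hpq : p ≤ q := by nlinarith
  have hroot {μ : ℝ} : (G.adjMatrix ℝ).charpoly.IsRoot μ ↔ ∃ i ∈ Finset.Icc 1 p, μ = lam i := by
    simp [hspec, IsRoot, eval_prod, prod_eq_zero_iff, sub_eq_zero]
  have h1 : 1 ∈ Finset.Icc 1 p := Finset.mem_Icc.2 ⟨le_rfl, by omega⟩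
  have hlam1 : lam 1 = r := by
    refine le_antisymm (EccSpec.le_of_isRoot_charpoly_adjMatrix hreg (hroot.2 ⟨1, h1, rfl⟩)) ?_
    obtain ⟨i, hi, hri⟩ := hroot.1 (EccSpec.isRoot_charpoly_adjMatrix hreg)
    rw [Finset.mem_Icc] at hi h1
    rw [hri]
    -- `r` occurs at some index `i ≥ 1`, and the list is decreasing.
    exact hlam h1 hi hi.1
  have hins : Finset.Icc 1 p = insert 1 (Finset.Icc 2 p) := by
    ext i; simp only [Finset.mem_Icc, Finset.mem_insert]; omega
  have hdisc : 0 ≤ (3 * q - 8 * r + 3 : ℝ) ^ 2 + 16 * (p - 2) * (q - r) := by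
    have hp2 : (2 : ℝ) ≤ p := by exact_mod_cast hr.trans hrp.le
    have hqr : (r : ℝ) ≤ q := by exact_mod_cast hrp.le.trans hpq
    have := mul_nonneg (sub_nonneg.2 hp2) (sub_nonneg.2 hqr)
    nlinarith [sq_nonneg (3 * q - 8 * r + 3 : ℝ)]
  have hquot := EccSpec.roots_quadratic (b := (3 * q - 4 * r + 3 : ℝ))
    (c := 6 * r * (q - 2 * r + 1) - 4 * (q - r) * (p - 2)) (by ring) hdisc
  refine ⟨EccSpec.centralGraph_connected htri, hlam1, ?_, _, rfl,
    EccSpec.isEquitableQuotient_eccMatrix_centralGraph hp hq hr hreg htri, ?_⟩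
  · have hchar := EccSpec.charpoly_eccMatrix_centralGraph hr hreg htri (s := Finset.Icc 2 p)
      (i₀ := 1) (by simp) hlam1 (hins ▸ hspec) hp hq hpq
    have hne := (Matrix.charpoly_monic (EccSpec.eccMatrix (EccSpec.centralGraph G))).ne_zero
    rw [hchar] at hne
    rw [EccSpec.eccSpectrum, hchar, roots_mul hne, roots_mul (left_ne_zero_of_mul hne), hquot,
      roots_pow, roots_X_sub_C, Multiset.nsmul_singleton,
      roots_prod _ _ (right_ne_zero_of_mul (left_ne_zero_of_mul hne))]
    congr 2
    refine Finset.sum_congr rfl fun i hi => EccSpec.roots_quadratic (by ring) ?_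
    have hi' : i ∈ Finset.Icc 1 p := hins ▸ Finset.mem_insert_of_mem hi
    have := EccSpec.neg_le_of_isRoot_charpoly_adjMatrix hreg (hroot.2 ⟨i, hi', rfl⟩)
    positivity
  · rw [← hquot, Matrix.charpoly_fin_two, Matrix.trace_fin_two_of, Matrix.det_fin_two_of]
    congr 4
    · congr 1
      ring
    · ring
    · ring
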